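/- Let $n\ge 1$ and let $\tau=(x_1,\dots,x_n)$ be a finite real time series. The \emph{horizon visibility graph} $\mathrm{HVG}_\infty(\tau)$ has vertices $0,1,\dots,n+1$. With $x_0=x_{n+1}=\infty$, vertices $i<j$ are adjacent iff $x_k<x_i$ and $x_k<x_j$ for all $i<k<j$. The \emph{time series merge tree} $T_{\check\tau}$ is the merge tree of the path $0-1-\cdots-n$ in which the edge joining $i-1$ and $i$ has weight $x_i$. Its vertices are the vertex sets of the connected components of the subgraphs $\check\tau_a$ ($a\in\mathbb R$) formed by all vertices and the edges of weight at most $a$. They are ordered by inclusion; the root is $\{0,\dots,n\}$ and the leaves are $\{0\},\dots,\{n\}$. As usual, a root edge ending in a further vertex $\infty$ is attached above the root. A plane rooted tree with leaves $0,\dots,n$ in this order, in which no vertex has exactly one child, is drawn in the closed disk with $\infty,0,1,\dots,n$ placed in this circular order on the boundary circle. Its \emph{dual} has as vertices the $n+2$ regions of the disk, where region $k$ is the one at the boundary arc between $k-1$ and $k$ (with $-1$ and $n+1$ both read as $\infty$), and two regions are adjacent iff they share an edge of the tree. The \emph{first Horton pruning} of a rooted tree is obtained by removing all leaves together with the edges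 above them and then suppressing all vertices of degree two (the root edge counts towards the degree of the root). Let $\mathrm{PL}_\tau:\mathbb R\to\mathbb R$ be the piecewise linear interpolation: $\mathrm{PL}_\tau(k)=x_k$ for $1\le k\le n$, affine on each $[k,k+1]$ with $1\le k<n$, and constant on $(-\infty,1]$ and on $[n,\infty)$. The points of its merge tree are the pairs $(C,\lambda)$ with $C$ a connected component of $\{t:\mathrm{PL}_\tau(t)\le\lambda\}$, where $(C,\lambda)\le(C',\lambda')$ iff $\lambda\le\lambda'$ and $C\subseteq C'$. Its \emph{branch structure} is the rooted tree whose vertices are the minimal points (births of components) and the least upper bounds of two incomparable points (mergers), with the induced order. \textbf{Proposition.} $T_{\check\tau}$ is the unique plane tree of the above kind whose dual is $\mathrm{HVG}_\infty(\tau)$, and the first Horton pruning of this tree is isomorphic, as a rooted tree and with the left-to-right order of branches preserved, to the branch structure of the merge tree of $\mathrm{PL}_\tau$. -/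

import Mathlib

noncomputable section

/-! ### Horizon visibility graphs -/

/-- The horizontal visibility graph of a finite series with values in a linear order:
`i` and `j` are adjacent iff every value strictly between them lies strictly below both. -/
def horizontalVisibilityGraph {m : ℕ} {α : Type*} [LinearOrder α] (x : Fin m → α) :
    SimpleGraph (Fin m) where
  Adj i j := i ≠ j ∧ ∀ k, min i j < k → k < max i j → x k < x i ∧ x k < x j
  symm := ⟨fun i j h => ⟨h.1.symm, fun k h₁ h₂ =>
    (h.2 k (by rwa [min_comm]) (by rwa [max_comm])).symm⟩⟩
  loopless := ⟨fun _ h => h.1 rfl⟩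

/-- The series `(∞, x₁, …, xₙ, ∞)`. -/
def horizonExtension {n : ℕ} (τ : Fin n → ℝ) : Fin (n + 2) → WithTop ℝ :=
  Fin.cons (α := fun _ => WithTop ℝ) ⊤
    (Fin.snoc (α := fun _ => WithTop ℝ) (fun i => (τ i : WithTop ℝ)) ⊤)

/-- The horizon visibility graph of a time series. -/
def horizonVisibilityGraph {n : ℕ} (τ : Fin n → ℝ) : SimpleGraph (Fin (n + 2)) :=
  horizontalVisibilityGraph (horizonExtension τ)

/-! ### Merge trees of weighted graphs and of time series -/

/-- The sublevel graph: all vertices, and the edges of weight at most `a`. -/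
def sublevelGraph {V : Type*} (G : SimpleGraph V) (w : Sym2 V → ℝ) (a : ℝ) : SimpleGraph V where
  Adj u v := G.Adj u v ∧ w s(u, v) ≤ a
  symm := ⟨fun u v h => ⟨h.1.symm, by rw [Sym2.eq_swap]; exact h.2⟩⟩
  loopless := ⟨fun u h => G.loopless.irrefl u h.1⟩

/-- The merge tree of a weighted graph: its vertices are the vertex sets of the connected
components of the sublevel graphs, and a vertex `C` is a descendant of `D` iff `C ⊆ D`. -/
def graphMergeTree {V : Type*} (G : SimpleGraph V) (w : Sym2 V → ℝ) : Set (Set V) :=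
  {C | ∃ a : ℝ, ∃ c : (sublevelGraph G w a).ConnectedComponent, C = c.supp}

/-- The weights of the path `0 - 1 - ⋯ - n`: the edge joining `i` and `i + 1` carries the
entry `τ i` (the value at pairs that are not edges of the path plays no role). -/
def pathWeight {n : ℕ} (τ : Fin n → ℝ) (e : Sym2 (Fin (n + 1))) : ℝ :=
  if h : (e.inf : ℕ) < n then τ ⟨e.inf, h⟩ else 0

/-- The merge tree of a time series: the merge tree of its weighted path. -/
def timeSeriesMergeTree {n : ℕ} (τ : Fin n → ℝ) : Set (Set (Fin (n + 1))) :=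
  graphMergeTree (SimpleGraph.pathGraph (n + 1)) (pathWeight τ)

/-! ### Plane trees and their duals -/

/-- A plane rooted tree with leaves `0, 1, …, n` in this order and without vertices having exactly
one child, encoded by the leaf sets of its principal subtrees: each vertex is identified
with the set of leaves descended from it, and also with the edge above it (the root edge, for
the root). -/
structure IsPlaneTree {n : ℕ} (T : Set (Set (Fin (n + 1)))) : Prop where
  root_mem : Set.univ ∈ T
  leaf_mem : ∀ i, {i} ∈ T
  nonempty : ∀ C ∈ T, C.Nonempty
  laminar : ∀ C ∈ T, ∀ D ∈ T, C ⊆ D ∨ D ⊆ C ∨ Disjoint C D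
  ordConnected : ∀ C ∈ T, C.OrdConnected

/-- The tree is drawn in the closed disk with the leaves `0, …, n` and the upper end `∞` of the
root edge on the circle, in the circular order `∞, 0, 1, …, n`. The region numbered `k` is the one
at the arc between the consecutive external vertices `k - 1` and `k` (where `-1` and `n + 1`
both mean `∞`); apart from this arc its boundary is the tree path between these two vertices.
So the edge above the vertex `C` bounds the region iff it separates them, that is, iff
exactly one of them is in `C`. -/
def BoundsRegion {n : ℕ} (C : Set (Fin (n + 1))) (k : Fin (n + 2)) : Prop :=
  Xor (∃ i ∈ C, i.succ = k) (∃ i ∈ C, i.castSucc = k)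

/-- The dual of a plane tree in the disk: two regions are adjacent iff they share an edge of
the tree. -/
def dualGraph {n : ℕ} (T : Set (Set (Fin (n + 1)))) : SimpleGraph (Fin (n + 2)) where
  Adj i j := i ≠ j ∧ ∃ C ∈ T, BoundsRegion C i ∧ BoundsRegion C j
  symm := ⟨fun _ _ h => ⟨h.1.symm, h.2.imp fun _ hC => ⟨hC.1, hC.2.symm⟩⟩⟩
  loopless := ⟨fun _ h => h.1 rfl⟩

/-! ### Horton pruning -/

/-- What remains of a finite rooted tree (ordered by descent, root at the top, leaves minimal)
when all leaves and the edges above them are cut off. -/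
abbrev CutLeaves (P : Type*) [PartialOrder P] : Type _ := {v : P // ¬ IsMin v}

/-- Suppression of the degree-two vertices of a rooted tree. Every vertex, the root included,
has one edge above it, so the vertices of degree two are those with exactly one child. -/
abbrev ContractChains (P : Type*) [PartialOrder P] : Type _ := {v : P // ¬ ∃! c, c ⋖ v}

/-- A single Horton pruning of a rooted tree. -/
abbrev HortonPruning (P : Type*) [PartialOrder P] : Type _ := ContractChains (CutLeaves P)

/-! ### Merge trees of functions -/

/-- A point of the merge tree of `f`: a connected component of a sublevel set of `f`, together
with its level. -/
@[ext]
structure MergePoint {X : Type*} [TopologicalSpace X] (f : X → ℝ) where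
  carrier : Set X
  level : ℝ
  isComponent : ∃ x, f x ≤ level ∧ carrier = connectedComponentIn {y | f y ≤ level} x

instance {X : Type*} [TopologicalSpace X] (f : X → ℝ) : PartialOrder (MergePoint f) where
  le p q := p.level ≤ q.level ∧ p.carrier ⊆ q.carrier
  le_refl p := ⟨le_refl _, subset_rfl⟩
  le_trans _ _ _ h₁ h₂ := ⟨h₁.1.trans h₂.1, h₁.2.trans h₂.2⟩
  le_antisymm _ _ h₁ h₂ :=
    MergePoint.ext (Set.Subset.antisymm h₁.2 h₂.2) (le_antisymm h₁.1 h₂.1)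

/-- The branch structure of the merge tree of `f`: the vertices are the points at which a
component is born (the minimal points) and those at which two different branches merge
(the least common ancestors of two incomparable points), ordered by descent. -/
abbrev MergeVertex {X : Type*} [TopologicalSpace X] (f : X → ℝ) : Type _ :=
  {p : MergePoint f // IsMin p ∨ ∃ q r : MergePoint f, ¬ q ≤ r ∧ ¬ r ≤ q ∧ IsLUB {q, r} p}

/-! ### Piecewise linear interpolation -/

/-- The entry with (one-based) index `k`; indices below `1` give the first and
indices above `n` the last entry. -/
def clampedEntry {n : ℕ} [NeZero n] (τ : Fin n → ℝ) (k : ℤ) : ℝ :=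
  τ ⟨min (k - 1).toNat (n - 1), by have := NeZero.pos n; omega⟩

/-- The piecewise linear interpolation of `τ = (x₁, …, xₙ)`: it takes the value `xₖ` at
`k = 1, …, n`, is affine on each `[k, k + 1]`, and is constant on `(-∞, 1]` and on `[n, ∞)`. -/
def plInterpolation {n : ℕ} [NeZero n] (τ : Fin n → ℝ) (t : ℝ) : ℝ :=
  (1 - Int.fract t) * clampedEntry τ ⌊t⌋ + Int.fract t * clampedEntry τ (⌊t⌋ + 1)

/-! ### Left-to-right order -/

/-- `A` lies entirely to the left of `B`. -/
def LeftOf {α : Type*} [LT α] (A B : Set α) : Prop := ∀ a ∈ A, ∀ b ∈ B, a < b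

end

/-! A plane tree is recorded as a family of nonempty intervals of leaves. The edge above `Set.Icc i
j` separates the region to the left of `i` from the one to the right of `j`, and every pair of
distinct regions arises from exactly one such interval. So the dual graph is a faithful encoding of
the family (`dualGraph_adj_castSucc_succ`), which gives uniqueness. An interval is a component of
the weighted path iff some level is at least all its inner weights and below the two weights leaving
it, with `∞` past the ends of the path. Taking the largest inner weight as the level turns this into
visibility.

For the pruning, an internal cluster is determined by its inner edges, and these are nodes of the
interpolation. Sending a cluster to the component around its heaviest inner edge, at that edge's
weight (`clusterPoint`), is left adjoint to sending a point of the merge tree to the cluster spanned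
by its nodes (`pointCluster`), and the composite on clusters is the identity. Points above a given
point of the merge tree form a chain. In such an order, a Galois coinsertion from a finite order
reaches every birth and every merger, and its value at `c` is one of these iff `c` does not have
exactly one child (`GaloisCoinsertion.isBranchPoint_l_iff`). Contracting chains therefore yields the
branch structure. Left-to-right order survives because incomparability is preserved and the position
of one node decides the order of disjoint intervals. -/

/-! ### Branch points and Galois coinsertions -/

section Forest

variable {P M : Type*} [PartialOrder P] [PartialOrder M] {l : P → M} {u : M → P}

/-- A point is a branch point if it is minimal or the join of two incomparable points. -/
def IsBranchPoint (p : M) : Prop :=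
  IsMin p ∨ ∃ q r : M, ¬ q ≤ r ∧ ¬ r ≤ q ∧ IsLUB {q, r} p

theorem GaloisCoinsertion.isMin_iff (gi : GaloisCoinsertion l u) (c : P) :
    IsMin (l c) ↔ IsMin c := by
  constructor
  · intro h d hd
    have := h (gi.gc.monotone_l hd)
    rwa [gi.l_le_l_iff] at this
  · intro h q hq
    have h₁ : u q ≤ c := by
      have := gi.gc.monotone_u hq
      rwa [gi.u_l_eq] at this
    exact (gi.gc c q).2 (h h₁)

theorem GaloisCoinsertion.l_u_eq_of_isMin (gi : GaloisCoinsertion l u) {p : M} (hp : IsMin p) :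
    l (u p) = p :=
  le_antisymm (gi.gc.l_u_le p) (hp (gi.gc.l_u_le p))

theorem GaloisCoinsertion.le_total_of_le (gi : GaloisCoinsertion l u)
    (hM : ∀ p q r : M, p ≤ q → p ≤ r → q ≤ r ∨ r ≤ q) {a b c : P} (hb : a ≤ b) (hc : a ≤ c) :
    b ≤ c ∨ c ≤ b := by
  have := hM _ _ _ (gi.gc.monotone_l hb) (gi.gc.monotone_l hc)
  rwa [gi.l_le_l_iff, gi.l_le_l_iff] at this

/-- In a forest, a point `q` below `p` with `u q = u p` is comparable to every other point
below `p`. -/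
theorem GaloisCoinsertion.u_lt_of_incomparable (gi : GaloisCoinsertion l u)
    (hM : ∀ p q r : M, p ≤ q → p ≤ r → q ≤ r ∨ r ≤ q) {p q r : M} (hq : q ≤ p) (hr : r ≤ p)
    (hqr : ¬ q ≤ r) (hrq : ¬ r ≤ q) : u q < u p := by
  refine lt_of_le_of_ne (gi.gc.monotone_u hq) fun h => ?_
  -- If `u q = u p`, then `l (u r)` lies below both `q` and `r`, which makes them comparable.
  have h₁ : l (u r) ≤ q := (gi.gc _ _).2 (h ▸ gi.gc.monotone_u hr)
  rcases hM _ _ _ h₁ (gi.gc.l_u_le r) with h | h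
  exacts [hqr h, hrq h]

/-- Both `q` and `l c` lie above `l (u q)`, hence are comparable, and `l c ≤ q` would give `c ≤ u
q`. -/
theorem GaloisCoinsertion.le_l_of_u_lt (gi : GaloisCoinsertion l u)
    (hM : ∀ p q r : M, p ≤ q → p ≤ r → q ≤ r ∨ r ≤ q) {q : M} {c : P} (h : u q < c) :
    q ≤ l c := by
  have h₁ : l (u q) ≤ l c := gi.gc.monotone_l h.le
  rcases hM _ _ _ (gi.gc.l_u_le q) h₁ with h₂ | h₂
  · exact h₂
  · exact absurd ((gi.gc _ _).1 h₂) h.not_ge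

theorem GaloisCoinsertion.l_u_eq_of_isLUB (gi : GaloisCoinsertion l u)
    (hM : ∀ p q r : M, p ≤ q → p ≤ r → q ≤ r ∨ r ≤ q) {p q r : M}
    (hqr : ¬ q ≤ r) (hrq : ¬ r ≤ q) (h : IsLUB {q, r} p) : l (u p) = p := by
  have hq : q ≤ p := h.1 (by simp)
  have hr : r ≤ p := h.1 (by simp)
  refine le_antisymm (gi.gc.l_u_le p) (h.2 ?_)
  rintro s (rfl | rfl)
  · exact gi.le_l_of_u_lt hM (gi.u_lt_of_incomparable hM hq hr hqr hrq)
  · exact gi.le_l_of_u_lt hM (gi.u_lt_of_incomparable hM hr hq hrq hqr)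

/-- Take children of `c` above `u q` and `u r`. If they were one child `a`, then either `l a` would
already bound `q` and `r`, contradicting leastness of `l c`, or `q` and `r` would be comparable. -/
theorem GaloisCoinsertion.exists_covBy_ne_of_isLUB [Finite P] (gi : GaloisCoinsertion l u)
    (hM : ∀ p q r : M, p ≤ q → p ≤ r → q ≤ r ∨ r ≤ q) {c : P} {q r : M}
    (hqr : ¬ q ≤ r) (hrq : ¬ r ≤ q) (h : IsLUB {q, r} (l c)) :
    ∃ a b, a ⋖ c ∧ b ⋖ c ∧ a ≠ b := by
  have hq : q ≤ l c := h.1 (by simp)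
  have hr : r ≤ l c := h.1 (by simp)
  have hq' := gi.u_lt_of_incomparable hM hq hr hqr hrq
  have hr' := gi.u_lt_of_incomparable hM hr hq hrq hqr
  rw [gi.u_l_eq] at hq' hr'
  obtain ⟨a, hqa, hac⟩ := exists_le_covBy_of_lt hq'
  obtain ⟨b, hrb, hbc⟩ := exists_le_covBy_of_lt hr'
  refine ⟨a, b, hac, hbc, ?_⟩
  rintro rfl
  rcases hM _ _ _ (gi.gc.l_u_le q) (gi.gc.monotone_l hqa) with h₁ | h₁
  · rcases hM _ _ _ (gi.gc.l_u_le r) (gi.gc.monotone_l hrb) with h₂ | h₂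
    · have : l c ≤ l a := h.2 (by rintro s (rfl | rfl) <;> assumption)
      rw [gi.l_le_l_iff] at this
      exact hac.lt.not_ge this
    · rcases hM _ _ _ (gi.gc.l_u_le q) ((gi.gc.monotone_l hqa).trans h₂) with h | h
      exacts [hqr h, hrq h]
  · rcases hM _ _ _ ((gi.gc.monotone_l hrb).trans h₁) (gi.gc.l_u_le r) with h | h
    exacts [hqr h, hrq h]

theorem GaloisCoinsertion.isLUB_l_of_covBy (gi : GaloisCoinsertion l u)
    (hM : ∀ p q r : M, p ≤ q → p ≤ r → q ≤ r ∨ r ≤ q) {a b c : P}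
    (ha : a ⋖ c) (hb : b ⋖ c) (hab : a ≠ b) : IsLUB {l a, l b} (l c) := by
  -- Two distinct children have join `c` already in `P`, because an upper bound of them is
  -- comparable to `c`; left adjoints preserve joins.
  have hc : IsLUB {a, b} c := by
    refine ⟨by rintro s (rfl | rfl); exacts [ha.le, hb.le], fun d hd => ?_⟩
    have had : a ≤ d := hd (by simp)
    have hbd : b ≤ d := hd (by simp)
    rcases gi.le_total_of_le hM had ha.le with h | h
    · rcases h.eq_or_lt with rfl | h
      · exact le_rfl
      · have h₁ : a = d := had.eq_or_lt.resolve_right fun h' => ha.2 h' h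
        have h₂ : b = d := hbd.eq_or_lt.resolve_right fun h' => hb.2 h' h
        exact absurd (h₁.trans h₂.symm) hab
    · exact h
  have := gi.gc.isLUB_l_image hc
  rwa [Set.image_pair] at this

theorem GaloisCoinsertion.isBranchPoint_l_iff [Finite P] (gi : GaloisCoinsertion l u)
    (hM : ∀ p q r : M, p ≤ q → p ≤ r → q ≤ r ∨ r ≤ q) (c : P) :
    IsBranchPoint (l c) ↔ ¬ ∃! d, d ⋖ c := by
  constructor
  · rintro (h | ⟨q, r, hqr, hrq, h⟩) ⟨d, hd, hu⟩
    · exact ((gi.isMin_iff c).1 h).not_lt hd.lt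
    · obtain ⟨a, b, ha, hb, hab⟩ := gi.exists_covBy_ne_of_isLUB hM hqr hrq h
      exact hab ((hu a ha).trans (hu b hb).symm)
  · intro h
    by_cases hc : IsMin c
    · exact Or.inl ((gi.isMin_iff c).2 hc)
    obtain ⟨x, hx⟩ := not_isMin_iff.1 hc
    obtain ⟨a, -, ha⟩ := exists_le_covBy_of_lt hx
    obtain ⟨b, hb, hba⟩ : ∃ b, b ⋖ c ∧ b ≠ a := by
      by_contra! H
      exact h ⟨a, ha, H⟩
    refine Or.inr ⟨l a, l b, ?_, ?_, gi.isLUB_l_of_covBy hM ha hb hba.symm⟩ <;>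
      rw [gi.l_le_l_iff] <;> intro hle
    · exact hba (hle.eq_or_lt.resolve_right fun h' => ha.2 h' hb.lt).symm
    · exact hba (hle.eq_or_lt.resolve_right fun h' => hb.2 h' ha.lt)

theorem GaloisCoinsertion.l_u_eq_of_isBranchPoint (gi : GaloisCoinsertion l u)
    (hM : ∀ p q r : M, p ≤ q → p ≤ r → q ≤ r ∨ r ≤ q) {p : M} (hp : IsBranchPoint p) :
    l (u p) = p := by
  rcases hp with h | ⟨q, r, hqr, hrq, h⟩
  exacts [gi.l_u_eq_of_isMin h, gi.l_u_eq_of_isLUB hM hqr hrq h]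

/-- A Galois coinsertion of a finite order into a forest identifies the finite order, with its
chains contracted, with the branch points of the forest. -/
theorem GaloisCoinsertion.exists_orderIso_contractChains [Finite P]
    (gi : GaloisCoinsertion l u) (hM : ∀ p q r : M, p ≤ q → p ≤ r → q ≤ r ∨ r ≤ q) :
    ∃ e : ContractChains P ≃o {p : M // IsBranchPoint p}, ∀ c, (e c).1 = l c.1 := by
  refine ⟨⟨⟨fun c => ⟨l c.1, (gi.isBranchPoint_l_iff hM c.1).2 c.2⟩,
    fun p => ⟨u p.1, ?_⟩, ?_, ?_⟩, ?_⟩, fun c => rfl⟩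
  · rw [← gi.isBranchPoint_l_iff hM, gi.l_u_eq_of_isBranchPoint hM p.2]
    exact p.2
  · intro c
    exact Subtype.ext (gi.u_l_eq c.1)
  · intro p
    exact Subtype.ext (gi.l_u_eq_of_isBranchPoint hM p.2)
  · intro a b
    exact gi.l_le_l_iff

end Forest

/-! ### Clusters of a weighted path -/

section PathClusters

variable {n : ℕ} {τ : Fin n → ℝ} {a : ℝ}

/-- The edges of the path between the vertices `i` and `j` all have weight at most `a`. -/
def JoinedBelow (τ : Fin n → ℝ) (a : ℝ) (i j : Fin (n + 1)) : Prop :=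
  ∀ k : Fin n, min (i : ℕ) j ≤ k → (k : ℕ) < max (i : ℕ) j → τ k ≤ a

theorem JoinedBelow.symm {i j : Fin (n + 1)} (h : JoinedBelow τ a i j) : JoinedBelow τ a j i :=
  fun k h₁ h₂ => h k (by omega) (by omega)

theorem JoinedBelow.trans {i j k : Fin (n + 1)} (h : JoinedBelow τ a i j)
    (h' : JoinedBelow τ a j k) : JoinedBelow τ a i k := fun l h₁ h₂ => by
  by_cases hl : min (i : ℕ) j ≤ l ∧ (l : ℕ) < max (i : ℕ) j
  · exact h l hl.1 hl.2
  · exact h' l (by omega) (by omega)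

theorem JoinedBelow.refl (i : Fin (n + 1)) : JoinedBelow τ a i i :=
  fun k h₁ h₂ => by omega

theorem JoinedBelow.mono {b : ℝ} (hab : a ≤ b) {i j : Fin (n + 1)} (h : JoinedBelow τ a i j) :
    JoinedBelow τ b i j :=
  fun k h₁ h₂ => (h k h₁ h₂).trans hab

theorem joinedBelow_castSucc_succ {k : Fin n} :
    JoinedBelow τ a k.castSucc k.succ ↔ τ k ≤ a := by
  constructor
  · intro h
    exact h k (by simp) (by simp)
  · intro h l h₁ h₂
    have : l = k := by
      ext
      simp at h₁ h₂
      omega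
    rwa [this]

theorem sublevelGraph_path_adj {i j : Fin (n + 1)} :
    (sublevelGraph (SimpleGraph.pathGraph (n + 1)) (pathWeight τ) a).Adj i j ↔
      ((i : ℕ) + 1 = j ∨ (j : ℕ) + 1 = i) ∧ JoinedBelow τ a i j := by
  have key : ∀ {i j : Fin (n + 1)}, (i : ℕ) + 1 = j →
      (pathWeight τ s(i, j) ≤ a ↔ JoinedBelow τ a i j) := by
    intro i j h
    obtain ⟨k, rfl⟩ : ∃ k : Fin n, k.castSucc = i := ⟨⟨i, by omega⟩, rfl⟩
    obtain rfl : j = k.succ := by ext; simpa using h.symm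
    rw [joinedBelow_castSucc_succ, pathWeight, dif_pos (by simp [Fin.castSucc_lt_succ.le])]
    simp [Fin.castSucc_lt_succ.le]
  change (SimpleGraph.pathGraph (n + 1)).Adj i j ∧ _ ↔ _
  rw [SimpleGraph.pathGraph_adj]
  refine and_congr_right ?_
  rintro (h | h)
  · exact key h
  · rw [Sym2.eq_swap, key h]
    exact ⟨JoinedBelow.symm, JoinedBelow.symm⟩

theorem sublevelGraph_path_reachable {i j : Fin (n + 1)} :
    (sublevelGraph (SimpleGraph.pathGraph (n + 1)) (pathWeight τ) a).Reachable i j ↔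
      JoinedBelow τ a i j := by
  constructor
  · rintro ⟨w⟩
    induction w with
    | nil => exact JoinedBelow.refl _
    | cons h _ ih => exact (sublevelGraph_path_adj.1 h).2.trans ih
  · have key : ∀ (d : ℕ) (i j : Fin (n + 1)), (i : ℕ) + d = j → JoinedBelow τ a i j →
        (sublevelGraph (SimpleGraph.pathGraph (n + 1)) (pathWeight τ) a).Reachable i j := by
      intro d
      induction d with
      | zero =>
        intro i j h _
        obtain rfl : i = j := Fin.ext h
        exact SimpleGraph.Reachable.refl _
      | succ d ih =>
        intro i j h hij
        have hi : (i : ℕ) + 1 < n + 1 := by omega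
        have h₁ : (sublevelGraph (SimpleGraph.pathGraph (n + 1)) (pathWeight τ) a).Adj i
            ⟨i + 1, hi⟩ :=
          sublevelGraph_path_adj.2 ⟨Or.inl rfl, fun k h₁ h₂ => by
            simp only at h₁ h₂
            exact hij k (by omega) (by omega)⟩
        refine h₁.reachable.trans (ih _ _ (by simp only; omega) fun k h₁ h₂ => ?_)
        simp only at h₁ h₂
        exact hij k (by omega) (by omega)
    intro h
    rcases le_total (i : ℕ) j with hij | hij
    · exact key (j - i) i j (by omega) h
    · exact (key (i - j) j i (by omega) h.symm).symm

theorem mem_timeSeriesMergeTree {C : Set (Fin (n + 1))} :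
    C ∈ timeSeriesMergeTree τ ↔ ∃ a i, C = {j | JoinedBelow τ a i j} := by
  have key : ∀ a i, ((sublevelGraph (SimpleGraph.pathGraph (n + 1)) (pathWeight τ)
      a).connectedComponentMk i).supp = {j | JoinedBelow τ a i j} := by
    intro a i
    ext j
    rw [SimpleGraph.ConnectedComponent.mem_supp_iff, SimpleGraph.ConnectedComponent.eq,
      sublevelGraph_path_reachable]
    exact ⟨JoinedBelow.symm, JoinedBelow.symm⟩
  constructor
  · rintro ⟨a, c, rfl⟩
    induction c using SimpleGraph.ConnectedComponent.ind with
    | h i => exact ⟨a, i, key a i⟩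
  · rintro ⟨a, i, rfl⟩
    exact ⟨a, _, (key a i).symm⟩

theorem joinedBelow_setOf_eq {i j : Fin (n + 1)} (h : JoinedBelow τ a i j) :
    {k | JoinedBelow τ a i k} = {k | JoinedBelow τ a j k} := by
  ext k
  exact ⟨h.symm.trans, h.trans⟩

/-- One level serves every base point in the cluster. -/
theorem exists_level_of_mem_timeSeriesMergeTree {C : Set (Fin (n + 1))}
    (hC : C ∈ timeSeriesMergeTree τ) : ∃ a, ∀ i ∈ C, C = {j | JoinedBelow τ a i j} := by
  obtain ⟨a, i, rfl⟩ := mem_timeSeriesMergeTree.1 hC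
  exact ⟨a, fun j hj => joinedBelow_setOf_eq hj⟩

theorem ordConnected_of_mem_timeSeriesMergeTree {C : Set (Fin (n + 1))}
    (hC : C ∈ timeSeriesMergeTree τ) : C.OrdConnected := by
  obtain ⟨a, h⟩ := exists_level_of_mem_timeSeriesMergeTree hC
  refine ⟨fun i hi j hj k hk => ?_⟩
  have hj' : JoinedBelow τ a i j := by rw [h i hi] at hj; exact hj
  rw [h i hi]
  have h₁ : (i : ℕ) ≤ k := hk.1
  have h₂ : (k : ℕ) ≤ j := hk.2
  exact fun l hl hl' => hj' l (by omega) (by omega)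

theorem nonempty_of_mem_timeSeriesMergeTree {C : Set (Fin (n + 1))}
    (hC : C ∈ timeSeriesMergeTree τ) : C.Nonempty := by
  obtain ⟨a, i, rfl⟩ := mem_timeSeriesMergeTree.1 hC
  exact ⟨i, JoinedBelow.refl i⟩

theorem timeSeriesMergeTree_laminar {C D : Set (Fin (n + 1))}
    (hC : C ∈ timeSeriesMergeTree τ) (hD : D ∈ timeSeriesMergeTree τ) :
    C ⊆ D ∨ D ⊆ C ∨ Disjoint C D := by
  obtain ⟨a, hCa⟩ := exists_level_of_mem_timeSeriesMergeTree hC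
  obtain ⟨b, hDb⟩ := exists_level_of_mem_timeSeriesMergeTree hD
  by_cases h : Disjoint C D
  · exact Or.inr (Or.inr h)
  obtain ⟨i, hiC, hiD⟩ := Set.not_disjoint_iff.1 h
  rw [hCa i hiC, hDb i hiD]
  rcases le_total a b with hab | hab
  · exact Or.inl fun j hj => hj.mono hab
  · exact Or.inr (Or.inl fun j hj => hj.mono hab)

theorem exists_lt_all [NeZero n] (τ : Fin n → ℝ) : ∃ a, ∀ k, a < τ k := by
  obtain ⟨k, hk⟩ := Finite.exists_min τ
  exact ⟨τ k - 1, fun l => by linarith [hk l]⟩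

theorem isPlaneTree_timeSeriesMergeTree [NeZero n] (τ : Fin n → ℝ) :
    IsPlaneTree (timeSeriesMergeTree τ) where
  root_mem := by
    obtain ⟨k, hk⟩ := Finite.exists_max τ
    refine mem_timeSeriesMergeTree.2 ⟨τ k, 0, ?_⟩
    exact (Set.eq_univ_of_forall fun j l _ _ => hk l).symm
  leaf_mem i := by
    obtain ⟨a, ha⟩ := exists_lt_all τ
    refine mem_timeSeriesMergeTree.2 ⟨a, i, ?_⟩
    ext j
    rw [Set.mem_singleton_iff, Set.mem_ofPred_eq]
    constructor
    · rintro rfl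
      exact JoinedBelow.refl _
    · intro h
      by_contra hij
      have hij' : (j : ℕ) ≠ i := fun h => hij (Fin.ext h)
      exact (ha ⟨min i j, by omega⟩).not_ge (h _ (by simp) (by simp only; omega))
  nonempty _ := nonempty_of_mem_timeSeriesMergeTree
  laminar _ hC _ hD := timeSeriesMergeTree_laminar hC hD
  ordConnected _ := ordConnected_of_mem_timeSeriesMergeTree

end PathClusters

/-! ### Clusters as visible pairs -/

section Dual

variable {n : ℕ} {τ : Fin n → ℝ}

theorem exists_eq_Icc_of_ordConnected {α : Type*} [LinearOrder α] [Finite α] {C : Set α}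
    (hC : C.OrdConnected) (hne : C.Nonempty) : ∃ i j, i ≤ j ∧ C = Set.Icc i j := by
  obtain ⟨i, hi, hmin⟩ := C.toFinite.exists_minimalFor id C hne
  obtain ⟨j, hj, hmax⟩ := C.toFinite.exists_maximalFor id C hne
  have hmin' : ∀ k ∈ C, i ≤ k := fun k hk => (le_total i k).elim id fun h => hmin hk h
  have hmax' : ∀ k ∈ C, k ≤ j := fun k hk => (le_total k j).elim id fun h => hmax hk h
  exact ⟨i, j, hmin' j hj,
    Set.Subset.antisymm (fun k hk => ⟨hmin' k hk, hmax' k hk⟩) (hC.out hi hj)⟩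

/-- The successors of the leaves fill `i + 1, …, j + 1` and the leaves themselves `i, …, j`; only
the two extremes fail to cancel. -/
theorem boundsRegion_Icc {i j : Fin (n + 1)} (hij : i ≤ j) (k : Fin (n + 2)) :
    BoundsRegion (Set.Icc i j) k ↔ k = i.castSucc ∨ k = j.succ := by
  have hij' : (i : ℕ) ≤ j := hij
  have h₁ : (∃ l ∈ Set.Icc i j, l.succ = k) ↔ (i : ℕ) + 1 ≤ k ∧ (k : ℕ) ≤ j + 1 := by
    constructor
    · rintro ⟨l, ⟨hl, hl'⟩, rfl⟩
      exact ⟨by simpa using hl, by simpa using hl'⟩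
    · rintro ⟨h, h'⟩
      refine ⟨⟨k - 1, by omega⟩, ⟨?_, ?_⟩, ?_⟩
      · rw [Fin.le_def]; simp only; omega
      · rw [Fin.le_def]; simp only; omega
      · ext; simp only [Fin.val_succ]; omega
  have h₂ : (∃ l ∈ Set.Icc i j, l.castSucc = k) ↔ (i : ℕ) ≤ k ∧ (k : ℕ) ≤ j := by
    constructor
    · rintro ⟨l, ⟨hl, hl'⟩, rfl⟩
      exact ⟨by simpa using hl, by simpa using hl'⟩
    · rintro ⟨h, h'⟩
      exact ⟨⟨k, by omega⟩, ⟨h, h'⟩, rfl⟩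
  rw [BoundsRegion, h₁, h₂, Fin.ext_iff, Fin.ext_iff, Fin.val_castSucc, Fin.val_succ, xor_def]
  omega

theorem dualGraph_adj_castSucc_succ {T : Set (Set (Fin (n + 1)))}
    (hne : ∀ C ∈ T, C.Nonempty) (hoc : ∀ C ∈ T, C.OrdConnected) {i j : Fin (n + 1)}
    (hij : i ≤ j) : (dualGraph T).Adj i.castSucc j.succ ↔ Set.Icc i j ∈ T := by
  have hij' : (i : ℕ) ≤ j := hij
  constructor
  · rintro ⟨-, C, hC, h₁, h₂⟩
    obtain ⟨k, l, hkl, rfl⟩ := exists_eq_Icc_of_ordConnected (hoc C hC) (hne C hC)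
    have hkl' : (k : ℕ) ≤ l := hkl
    rw [boundsRegion_Icc hkl] at h₁ h₂
    simp only [Fin.ext_iff, Fin.val_castSucc, Fin.val_succ] at h₁ h₂
    obtain rfl : k = i := by ext; omega
    obtain rfl : l = j := by ext; omega
    exact hC
  · intro h
    refine ⟨?_, _, h, (boundsRegion_Icc hij _).2 (Or.inl rfl),
      (boundsRegion_Icc hij _).2 (Or.inr rfl)⟩
    rw [Ne, Fin.ext_iff]
    simp only [Fin.val_castSucc, Fin.val_succ]
    omega

theorem simpleGraph_ext_castSucc_succ {G H : SimpleGraph (Fin (n + 2))}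
    (h : ∀ i j : Fin (n + 1), i ≤ j → (G.Adj i.castSucc j.succ ↔ H.Adj i.castSucc j.succ)) :
    G = H := by
  have key : ∀ k l : Fin (n + 2), k < l → (G.Adj k l ↔ H.Adj k l) := by
    intro k l hkl
    have hkl' : (k : ℕ) < l := hkl
    have := h ⟨k, by omega⟩ ⟨l - 1, by omega⟩ (by rw [Fin.le_def]; simp only; omega)
    have hk : Fin.castSucc ⟨(k : ℕ), by omega⟩ = k := rfl
    have hl : Fin.succ ⟨(l : ℕ) - 1, by omega⟩ = l := by ext; simp only [Fin.val_succ]; omega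
    rwa [hk, hl] at this
  ext k l
  rcases lt_trichotomy k l with hkl | rfl | hkl
  · exact key k l hkl
  · simp
  · rw [G.adj_comm, H.adj_comm]
    exact key l k hkl

theorem isPlaneTree_eq_of_dualGraph_eq {T T' : Set (Set (Fin (n + 1)))} (hT : IsPlaneTree T)
    (hT' : IsPlaneTree T') (h : dualGraph T = dualGraph T') : T = T' := by
  have key : ∀ {T T' : Set (Set (Fin (n + 1)))}, IsPlaneTree T → IsPlaneTree T' →
      dualGraph T = dualGraph T' → T ⊆ T' := by
    intro T T' hT hT' h C hC
    obtain ⟨i, j, hij, rfl⟩ := exists_eq_Icc_of_ordConnected (hT.ordConnected C hC)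
      (hT.nonempty C hC)
    rw [← dualGraph_adj_castSucc_succ hT.nonempty hT.ordConnected hij, h] at hC
    exact (dualGraph_adj_castSucc_succ hT'.nonempty hT'.ordConnected hij).1 hC
  exact Set.Subset.antisymm (key hT hT' h) (key hT' hT h.symm)

theorem horizonExtension_castSucc_succ (k : Fin n) :
    horizonExtension τ k.castSucc.succ = τ k := by
  simp [horizonExtension]

/-- The edge `k` is the one entering `i` from the left. There is none at `i = 0`, where the
condition is vacuous and the extension is `∞`. -/
theorem lt_horizonExtension_castSucc_iff {a : ℝ} {i : Fin (n + 1)} :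
    (a : WithTop ℝ) < horizonExtension τ i.castSucc ↔ ∀ k : Fin n, k.succ = i → a < τ k := by
  induction i using Fin.cases with
  | zero => simp [horizonExtension, Fin.succ_ne_zero]
  | succ k =>
    rw [← Fin.succ_castSucc, horizonExtension_castSucc_succ, WithTop.coe_lt_coe]
    constructor
    · intro h l hl
      rwa [Fin.succ_injective _ hl]
    · intro h
      exact h k rfl

theorem lt_horizonExtension_succ_iff {a : ℝ} {j : Fin (n + 1)} :
    (a : WithTop ℝ) < horizonExtension τ j.succ ↔ ∀ k : Fin n, k.castSucc = j → a < τ k := by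
  induction j using Fin.lastCases with
  | last =>
    have : ∀ k : Fin n, k.castSucc ≠ Fin.last n := fun k => k.castSucc_lt_last.ne
    simp [horizonExtension, this]
  | cast k =>
    rw [horizonExtension_castSucc_succ, WithTop.coe_lt_coe]
    constructor
    · intro h l hl
      rwa [Fin.castSucc_injective _ hl]
    · intro h
      exact h k rfl

theorem horizonVisibilityGraph_adj_castSucc_succ {i j : Fin (n + 1)} (hij : i ≤ j) :
    (horizonVisibilityGraph τ).Adj i.castSucc j.succ ↔
      ∀ k : Fin n, (i : ℕ) ≤ k → (k : ℕ) < j →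
        (τ k : WithTop ℝ) < horizonExtension τ i.castSucc ∧
        (τ k : WithTop ℝ) < horizonExtension τ j.succ := by
  have hlt : i.castSucc < j.succ := Fin.castSucc_lt_succ_iff.2 hij
  change (i.castSucc ≠ j.succ ∧ _) ↔ _
  rw [min_eq_left hlt.le, max_eq_right hlt.le]
  constructor
  · rintro ⟨-, h⟩ k h₁ h₂
    have := h k.castSucc.succ (by rw [Fin.lt_def]; simp; omega) (by rw [Fin.lt_def]; simp; omega)
    rwa [horizonExtension_castSucc_succ] at this
  · refine fun h => ⟨hlt.ne, fun l h₁ h₂ => ?_⟩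
    rw [Fin.lt_def, Fin.val_castSucc] at h₁
    rw [Fin.lt_def, Fin.val_succ] at h₂
    obtain ⟨k, rfl⟩ : ∃ k : Fin n, k.castSucc.succ = l :=
      ⟨⟨l - 1, by omega⟩, by ext; simp; omega⟩
    simp only [Fin.val_succ, Fin.val_castSucc] at h₁ h₂
    rw [horizonExtension_castSucc_succ]
    exact h k (by omega) (by omega)

theorem Icc_mem_timeSeriesMergeTree_iff {i j : Fin (n + 1)} (hij : i ≤ j) :
    Set.Icc i j ∈ timeSeriesMergeTree τ ↔ ∃ a : ℝ,
      (∀ k : Fin n, (i : ℕ) ≤ k → (k : ℕ) < j → τ k ≤ a) ∧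
        (a : WithTop ℝ) < horizonExtension τ i.castSucc ∧
        (a : WithTop ℝ) < horizonExtension τ j.succ := by
  have hij' : (i : ℕ) ≤ j := hij
  constructor
  · intro h
    obtain ⟨a, ha⟩ := exists_level_of_mem_timeSeriesMergeTree h
    have hi := ha i ⟨le_rfl, hij⟩
    have hmem : ∀ k, i ≤ k ∧ k ≤ j ↔ JoinedBelow τ a i k := fun k => Set.ext_iff.1 hi k
    have hj : JoinedBelow τ a i j := (hmem j).1 ⟨hij, le_rfl⟩
    refine ⟨a, fun k h₁ h₂ => hj k (by omega) (by omega), ?_, ?_⟩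
    · rw [lt_horizonExtension_castSucc_iff]
      rintro k rfl
      by_contra! hk
      have := (hmem k.castSucc).2 (joinedBelow_castSucc_succ.2 hk).symm
      exact this.1.not_gt Fin.castSucc_lt_succ
    · rw [lt_horizonExtension_succ_iff]
      rintro k rfl
      by_contra! hk
      have := (hmem k.succ).2 (hj.trans (joinedBelow_castSucc_succ.2 hk))
      exact this.2.not_gt Fin.castSucc_lt_succ
  · rintro ⟨a, ha, hi, hj⟩
    rw [lt_horizonExtension_castSucc_iff] at hi
    rw [lt_horizonExtension_succ_iff] at hj
    refine mem_timeSeriesMergeTree.2 ⟨a, i, Set.ext fun k => ⟨?_, ?_⟩⟩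
    · rintro ⟨h₁, h₂⟩ l hl hl'
      rw [Fin.le_def] at h₁ h₂
      exact ha l (by omega) (by omega)
    · intro h
      constructor
      · by_contra! hk
        rw [Fin.lt_def] at hk
        exact (hi ⟨i - 1, by omega⟩ (by ext; simp; omega)).not_ge
          (h _ (by simp only; omega) (by simp only; omega))
      · by_contra! hk
        rw [Fin.lt_def] at hk
        exact (hj ⟨j, by omega⟩ rfl).not_ge (h _ (by simp only; omega) (by simp only; omega))

theorem dualGraph_timeSeriesMergeTree (τ : Fin n → ℝ) :
    dualGraph (timeSeriesMergeTree τ) = horizonVisibilityGraph τ := by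
  refine simpleGraph_ext_castSucc_succ fun i j hij => ?_
  rw [dualGraph_adj_castSucc_succ (fun _ => nonempty_of_mem_timeSeriesMergeTree)
    (fun _ => ordConnected_of_mem_timeSeriesMergeTree) hij, Icc_mem_timeSeriesMergeTree_iff hij,
    horizonVisibilityGraph_adj_castSucc_succ hij]
  constructor
  · rintro ⟨a, ha, hi, hj⟩ k h₁ h₂
    have := WithTop.coe_le_coe.2 (ha k h₁ h₂)
    exact ⟨this.trans_lt hi, this.trans_lt hj⟩
  · intro h
    by_cases hne : {k : Fin n | (i : ℕ) ≤ k ∧ (k : ℕ) < j}.Nonempty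
    · obtain ⟨m, hm, hmax⟩ := Set.exists_max_image _ τ (Set.toFinite _) hne
      exact ⟨τ m, fun k h₁ h₂ => hmax k ⟨h₁, h₂⟩, h m hm.1 hm.2⟩
    -- Here the interval is a single leaf without inner edges, so any real level below both outer
    -- values works.
    · obtain ⟨b, hb⟩ := exists_lt (min (horizonExtension τ i.castSucc) (horizonExtension τ j.succ))
      lift b to ℝ using hb.ne_top
      exact ⟨b, fun k h₁ h₂ => absurd ⟨k, h₁, h₂⟩ hne, lt_min_iff.1 hb⟩

end Dual

/-! ### Points of merge trees -/

namespace MergePoint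

variable {X : Type*} [TopologicalSpace X] {f : X → ℝ}

theorem carrier_eq {p : MergePoint f} {x : X} (hx : x ∈ p.carrier) :
    p.carrier = connectedComponentIn {y | f y ≤ p.level} x := by
  obtain ⟨y, -, hp⟩ := p.isComponent
  rw [hp] at hx ⊢
  exact connectedComponentIn_eq hx

theorem nonempty_carrier (p : MergePoint f) : p.carrier.Nonempty := by
  obtain ⟨y, hy, hp⟩ := p.isComponent
  exact ⟨y, hp ▸ mem_connectedComponentIn hy⟩

theorem apply_le_level {p : MergePoint f} {x : X} (hx : x ∈ p.carrier) : f x ≤ p.level := by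
  obtain ⟨y, -, hp⟩ := p.isComponent
  rw [hp] at hx
  exact connectedComponentIn_subset {y | f y ≤ p.level} _ hx

theorem le_of_level_le {p q : MergePoint f} {x : X} (hp : x ∈ p.carrier) (hq : x ∈ q.carrier)
    (h : p.level ≤ q.level) : p ≤ q := by
  refine ⟨h, ?_⟩
  rw [carrier_eq hp, carrier_eq hq]
  exact connectedComponentIn_mono x fun y hy => le_trans hy h

theorem le_or_le_of_mem {p q : MergePoint f} {x : X} (hp : x ∈ p.carrier)
    (hq : x ∈ q.carrier) : p ≤ q ∨ q ≤ p :=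
  (le_total p.level q.level).imp (le_of_level_le hp hq) (le_of_level_le hq hp)

theorem le_or_le_of_le (p q r : MergePoint f) (hq : p ≤ q) (hr : p ≤ r) : q ≤ r ∨ r ≤ q := by
  obtain ⟨x, hx⟩ := p.nonempty_carrier
  exact le_or_le_of_mem (hq.2 hx) (hr.2 hx)

theorem ordConnected_carrier {f : ℝ → ℝ} (p : MergePoint f) : p.carrier.OrdConnected := by
  obtain ⟨y, -, hp⟩ := p.isComponent
  rw [hp]
  exact isPreconnected_connectedComponentIn.ordConnected

theorem mem_carrier_iff {f : ℝ → ℝ} {p : MergePoint f} {s t : ℝ} (hs : s ∈ p.carrier) :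
    t ∈ p.carrier ↔ Set.uIcc s t ⊆ {y | f y ≤ p.level} := by
  constructor
  · intro ht y hy
    exact apply_le_level (p.ordConnected_carrier.uIcc_subset hs ht hy)
  · intro h
    rw [carrier_eq hs]
    exact isPreconnected_uIcc.subset_connectedComponentIn Set.left_mem_uIcc h Set.right_mem_uIcc

end MergePoint

/-! ### The piecewise linear interpolation -/

section Interpolation

variable {n : ℕ}

/-- The abscissa of the entry with zero-based index `k`. -/
def node (k : Fin n) : ℝ := ((k : ℤ) + 1 : ℤ)

theorem node_eq (k : Fin n) : node k = (k : ℝ) + 1 := by simp [node]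

theorem node_le_node {k l : Fin n} : node k ≤ node l ↔ k ≤ l := by
  simp [node_eq]

theorem node_lt_node {k l : Fin n} : node k < node l ↔ k < l := by
  simp [node_eq]

variable [NeZero n] {τ : Fin n → ℝ}

theorem clampedEntry_node (k : Fin n) : clampedEntry τ ((k : ℤ) + 1) = τ k := by
  rw [clampedEntry]
  congr 1
  ext
  simp only
  omega

theorem clampedEntry_of_le_one {m : ℤ} (hm : m ≤ 1) : clampedEntry τ m = clampedEntry τ 1 := by
  rw [clampedEntry, clampedEntry]
  congr 1
  ext
  simp only
  omega

theorem clampedEntry_of_ge {m : ℤ} (hm : n ≤ m) : clampedEntry τ m = clampedEntry τ n := by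
  rw [clampedEntry, clampedEntry]
  congr 1
  ext
  simp only
  omega

/-- The right end is included although the floor jumps there, so the formula holds on whole closed
pieces. -/
theorem plInterpolation_affine {m : ℤ} {t : ℝ} (h₁ : m ≤ t) (h₂ : t ≤ m + 1) :
    plInterpolation τ t =
      (1 - (t - m)) * clampedEntry τ m + (t - m) * clampedEntry τ (m + 1) := by
  rcases h₂.eq_or_lt with rfl | h₂
  · have : ((m : ℝ) + 1) = ((m + 1 : ℤ) : ℝ) := by push_cast; ring
    rw [plInterpolation, this, Int.fract_intCast, Int.floor_intCast]
    push_cast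
    ring
  · have : ⌊t⌋ = m := Int.floor_eq_iff.2 ⟨h₁, h₂⟩
    rw [plInterpolation, Int.fract, this]

theorem plInterpolation_node (k : Fin n) : plInterpolation τ (node k) = τ k := by
  rw [plInterpolation, node, Int.fract_intCast, Int.floor_intCast, clampedEntry_node]
  ring

theorem plInterpolation_of_le_one {t : ℝ} (ht : t ≤ 1) :
    plInterpolation τ t = clampedEntry τ 1 := by
  rcases ht.eq_or_lt with rfl | ht
  · simp [plInterpolation]
  · have h : ⌊t⌋ < 1 := Int.floor_lt.2 (by simpa using ht)
    rw [plInterpolation, clampedEntry_of_le_one (by omega),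
      clampedEntry_of_le_one (m := ⌊t⌋ + 1) (by omega)]
    ring

theorem plInterpolation_of_ge {t : ℝ} (ht : n ≤ t) :
    plInterpolation τ t = clampedEntry τ n := by
  have h : (n : ℤ) ≤ ⌊t⌋ := Int.le_floor.2 (by simpa using ht)
  rw [plInterpolation, clampedEntry_of_ge h, clampedEntry_of_ge (m := ⌊t⌋ + 1) (by omega)]
  ring

/-- Sublevel sets of the interpolation are determined by its nodes. -/
theorem uIcc_node_subset_iff {i j : Fin n} {a : ℝ} :
    Set.uIcc (node i) (node j) ⊆ {t | plInterpolation τ t ≤ a} ↔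
      ∀ k ∈ Set.uIcc i j, τ k ≤ a := by
  have key : ∀ {i j : Fin n}, i ≤ j → (Set.Icc (node i) (node j) ⊆ {t | plInterpolation τ t ≤ a} ↔
      ∀ k ∈ Set.Icc i j, τ k ≤ a) := by
    intro i j hij
    constructor
    · intro h k hk
      rw [← plInterpolation_node (τ := τ) k]
      exact h ⟨node_le_node.2 hk.1, node_le_node.2 hk.2⟩
    · rintro h t ⟨h₁, h₂⟩
      change plInterpolation τ t ≤ a
      have hf₁ : (i : ℤ) + 1 ≤ ⌊t⌋ := Int.le_floor.2 h₁
      have hf₂ : ⌊t⌋ ≤ (j : ℤ) + 1 := by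
        have := Int.floor_mono h₂
        rwa [node, Int.floor_intCast] at this
      have entry : ∀ m : ℤ, (i : ℤ) + 1 ≤ m → m ≤ (j : ℤ) + 1 → clampedEntry τ m ≤ a := by
        intro m hm hm'
        obtain ⟨k, rfl⟩ : ∃ k : Fin n, (k : ℤ) + 1 = m :=
          ⟨⟨(m - 1).toNat, by omega⟩, by simp only; omega⟩
        rw [clampedEntry_node]
        exact h k ⟨by rw [Fin.le_def]; omega, by rw [Fin.le_def]; omega⟩
      -- At `t = node j` the defining formula also mentions the next entry, with coefficient zero,
      -- which need not be at most `a`.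
      rcases hf₂.eq_or_lt with hf | hf
      · obtain rfl : t = node j := le_antisymm h₂ (by rw [node, ← hf]; exact Int.floor_le t)
        rw [plInterpolation_node]
        exact h j ⟨hij, le_rfl⟩
      · have e₁ := entry ⌊t⌋ hf₁ hf₂
        have e₂ := entry (⌊t⌋ + 1) (by omega) (by omega)
        rw [plInterpolation]
        nlinarith [Int.fract_nonneg t, Int.fract_lt_one t]
  rcases le_total i j with h | h
  · rw [Set.uIcc_of_le h, Set.uIcc_of_le (node_le_node.2 h)]
    exact key h
  · rw [Set.uIcc_of_ge h, Set.uIcc_of_ge (node_le_node.2 h)]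
    exact key h

/-- Walk to the lower end of the affine piece, or to the nearest node on a constant end: the value
never rises. Hence every component contains a node. -/
theorem exists_node_uIcc_subset (t : ℝ) :
    ∃ k : Fin n, Set.uIcc t (node k) ⊆ {s | plInterpolation τ s ≤ plInterpolation τ t} := by
  have hn := NeZero.pos n
  by_cases h₁ : t ≤ 1
  · refine ⟨⟨0, hn⟩, fun s hs => ?_⟩
    have h₀ : node (⟨0, hn⟩ : Fin n) = 1 := by simp [node_eq]
    rw [h₀, Set.uIcc_of_le h₁] at hs
    change plInterpolation τ s ≤ plInterpolation τ t
    exact (plInterpolation_of_le_one hs.2).trans_le (plInterpolation_of_le_one h₁).ge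
  by_cases h₂ : (n : ℝ) ≤ t
  · refine ⟨⟨n - 1, by omega⟩, fun s hs => ?_⟩
    have h₀ : node (⟨n - 1, by omega⟩ : Fin n) = n := by
      rw [node_eq]
      simp only
      rw [Nat.cast_sub hn]
      simp
    rw [h₀, Set.uIcc_of_ge h₂] at hs
    change plInterpolation τ s ≤ plInterpolation τ t
    rw [plInterpolation_of_ge hs.1, plInterpolation_of_ge h₂]
  push Not at h₁ h₂
  have hm₁ : 1 ≤ ⌊t⌋ := Int.le_floor.2 (by simpa using h₁.le)
  have hm₂ : ⌊t⌋ < n := Int.floor_lt.2 (by simpa using h₂)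
  have ht₁ := Int.floor_le t
  have ht₂ := (Int.lt_floor_add_one t).le
  have ht := plInterpolation_affine (τ := τ) ht₁ ht₂
  rcases le_total (clampedEntry τ ⌊t⌋) (clampedEntry τ (⌊t⌋ + 1)) with h | h
  · refine ⟨⟨(⌊t⌋ - 1).toNat, by omega⟩, fun s hs => ?_⟩
    have h₀ : node (⟨(⌊t⌋ - 1).toNat, by omega⟩ : Fin n) = ⌊t⌋ := by
      rw [node]
      congr 1
      simp only
      omega
    rw [h₀, Set.uIcc_of_ge ht₁] at hs
    change plInterpolation τ s ≤ plInterpolation τ t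
    rw [ht, plInterpolation_affine hs.1 (hs.2.trans ht₂)]
    nlinarith [hs.2]
  · refine ⟨⟨⌊t⌋.toNat, by omega⟩, fun s hs => ?_⟩
    have h₀ : node (⟨⌊t⌋.toNat, by omega⟩ : Fin n) = ⌊t⌋ + 1 := by
      have h : ((⌊t⌋.toNat : ℕ) : ℤ) = ⌊t⌋ := by omega
      rw [node]
      simp only [h]
      push_cast
      rfl
    rw [h₀, Set.uIcc_of_le ht₂] at hs
    change plInterpolation τ s ≤ plInterpolation τ t
    rw [ht, plInterpolation_affine (ht₁.trans hs.1) hs.2]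
    nlinarith [hs.1]

theorem MergePoint.exists_node_mem (p : MergePoint (plInterpolation τ)) :
    ∃ k : Fin n, node k ∈ p.carrier := by
  obtain ⟨t, ht⟩ := p.nonempty_carrier
  obtain ⟨k, hk⟩ := exists_node_uIcc_subset (τ := τ) t
  exact ⟨k, (MergePoint.mem_carrier_iff ht).2 fun s hs =>
    le_trans (hk hs) (MergePoint.apply_le_level ht)⟩

theorem MergePoint.node_mem_iff {p : MergePoint (plInterpolation τ)} {k l : Fin n}
    (hk : node k ∈ p.carrier) :
    node l ∈ p.carrier ↔ ∀ i ∈ Set.uIcc k l, τ i ≤ p.level := by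
  rw [MergePoint.mem_carrier_iff hk, uIcc_node_subset_iff]

end Interpolation

/-! ### Inner edges of clusters -/

section InnerEdges

variable {n : ℕ} {τ : Fin n → ℝ}

/-- The edges of the path with both ends in `C`. -/
def innerEdges (C : Set (Fin (n + 1))) : Set (Fin n) :=
  {k | k.castSucc ∈ C ∧ k.succ ∈ C}

/-- The ends of the edges of `E`. -/
def edgeEnds (E : Set (Fin n)) : Set (Fin (n + 1)) :=
  {i | ∃ k ∈ E, i = k.castSucc ∨ i = k.succ}

theorem edgeEnds_innerEdges_subset (C : Set (Fin (n + 1))) : edgeEnds (innerEdges C) ⊆ C := by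
  rintro i ⟨k, hk, rfl | rfl⟩
  exacts [hk.1, hk.2]

theorem edgeEnds_mono {E F : Set (Fin n)} (h : E ⊆ F) : edgeEnds E ⊆ edgeEnds F := by
  rintro i ⟨k, hk, hi⟩
  exact ⟨k, h hk, hi⟩

theorem innerEdges_mono {C D : Set (Fin (n + 1))} (h : C ⊆ D) : innerEdges C ⊆ innerEdges D :=
  fun _ hk => ⟨h hk.1, h hk.2⟩

theorem edgeEnds_innerEdges {C : Set (Fin (n + 1))} (hC : C.OrdConnected) (hne : C.Nontrivial) :
    edgeEnds (innerEdges C) = C := by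
  refine Set.Subset.antisymm (edgeEnds_innerEdges_subset C) fun i hi => ?_
  obtain ⟨j, hj, hij⟩ := hne.exists_ne i
  have hj' : (j : ℕ) < n + 1 := j.2
  have hi' : (i : ℕ) < n + 1 := i.2
  rcases lt_or_gt_of_ne hij with h | h
  · rw [Fin.lt_def] at h
    obtain ⟨k, rfl⟩ : ∃ k : Fin n, k.succ = i := ⟨⟨i - 1, by omega⟩, by ext; simp; omega⟩
    refine ⟨k, ⟨hC.out hj hi ⟨?_, ?_⟩, hi⟩, Or.inr rfl⟩
    · rw [Fin.le_def]; simp at h ⊢; omega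
    · exact Fin.castSucc_lt_succ.le
  · rw [Fin.lt_def] at h
    obtain ⟨k, rfl⟩ : ∃ k : Fin n, k.castSucc = i := ⟨⟨i, by omega⟩, rfl⟩
    refine ⟨k, ⟨hi, hC.out hi hj ⟨?_, ?_⟩⟩, Or.inl rfl⟩
    · exact Fin.castSucc_lt_succ.le
    · rw [Fin.le_def]; simp at h ⊢; omega

/-- If both ends of `k` are ends of edges of `E`, then `k` lies between two edges of `E`. -/
theorem innerEdges_edgeEnds {E : Set (Fin n)} (hE : E.OrdConnected) :
    innerEdges (edgeEnds E) = E := by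
  refine Set.Subset.antisymm ?_ fun k hk => ⟨⟨k, hk, Or.inl rfl⟩, ⟨k, hk, Or.inr rfl⟩⟩
  rintro k ⟨⟨l, hl, hkl⟩, ⟨m, hm, hkm⟩⟩
  simp only [Fin.ext_iff, Fin.val_castSucc, Fin.val_succ] at hkl hkm
  exact hE.out hl hm ⟨by rw [Fin.le_def]; omega, by rw [Fin.le_def]; omega⟩

theorem innerEdges_nonempty {C : Set (Fin (n + 1))} (hC : C.OrdConnected) (hne : C.Nontrivial) :
    (innerEdges C).Nonempty := by
  have h := hne.nonempty
  rw [← edgeEnds_innerEdges hC hne] at h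
  obtain ⟨i, k, hk, -⟩ := h
  exact ⟨k, hk⟩

theorem innerEdges_ordConnected {C : Set (Fin (n + 1))} (hC : C.OrdConnected) :
    (innerEdges C).OrdConnected := by
  refine ⟨fun k hk l hl m hm => ?_⟩
  exact ⟨hC.out hk.1 hl.1 ⟨Fin.castSucc_le_castSucc_iff.2 hm.1, Fin.castSucc_le_castSucc_iff.2 hm.2⟩,
    hC.out hk.2 hl.2 ⟨Fin.succ_le_succ_iff.2 hm.1, Fin.succ_le_succ_iff.2 hm.2⟩⟩

theorem joinedBelow_castSucc_castSucc {a : ℝ} {k l : Fin n}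
    (h : ∀ i ∈ Set.uIcc k l, τ i ≤ a) : JoinedBelow τ a k.castSucc l.castSucc := by
  intro i h₁ h₂
  refine h i (Set.mem_uIcc.2 ?_)
  simp only [Fin.val_castSucc] at h₁ h₂
  simp only [Fin.le_def]
  omega

theorem mem_innerEdges_of_le {a : ℝ} {C : Set (Fin (n + 1))} {k l : Fin n}
    (hC : C = {j | JoinedBelow τ a k.castSucc j})
    (h : ∀ i ∈ Set.uIcc k l, τ i ≤ a) : l ∈ innerEdges C := by
  have h₁ : JoinedBelow τ a k.castSucc l.castSucc := joinedBelow_castSucc_castSucc h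
  have h₂ : JoinedBelow τ a k.castSucc l.succ :=
    h₁.trans (joinedBelow_castSucc_succ.2 (h l Set.right_mem_uIcc))
  rw [hC]
  exact ⟨h₁, h₂⟩

end InnerEdges

/-! ### The internal clusters inside the merge tree of the interpolation -/

section InternalClusters

variable {n : ℕ} {τ : Fin n → ℝ}

theorem ordConnected_internal (C : CutLeaves (timeSeriesMergeTree τ)) :
    (C.1 : Set (Fin (n + 1))).OrdConnected :=
  ordConnected_of_mem_timeSeriesMergeTree C.1.2

variable [NeZero n]

theorem not_isMin_iff_nontrivial (C : timeSeriesMergeTree τ) :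
    ¬ IsMin C ↔ (C : Set (Fin (n + 1))).Nontrivial := by
  have hT := isPlaneTree_timeSeriesMergeTree τ
  constructor
  · intro h
    by_contra hC
    rw [Set.not_nontrivial_iff] at hC
    refine h fun D hD i hi => ?_
    obtain ⟨j, hj⟩ := hT.nonempty D.1 D.2
    exact hC (hD hj) hi ▸ hj
  · rintro ⟨i, hi, j, hj, hij⟩ hmin
    have h : C ≤ ⟨{i}, hT.leaf_mem i⟩ := hmin (Set.singleton_subset_iff.2 hi)
    exact hij (h hj).symm

theorem nontrivial_internal (C : CutLeaves (timeSeriesMergeTree τ)) :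
    (C.1 : Set (Fin (n + 1))).Nontrivial :=
  (not_isMin_iff_nontrivial C.1).1 C.2

/-- Leaves have no inner edges and cannot be told apart this way; cutting them off makes inner edges
a faithful description. -/
theorem internal_le_iff {C D : CutLeaves (timeSeriesMergeTree τ)} :
    C ≤ D ↔ innerEdges (C.1 : Set (Fin (n + 1))) ⊆ innerEdges (D.1 : Set (Fin (n + 1))) := by
  refine ⟨fun h => innerEdges_mono h, fun h => ?_⟩
  change (C.1 : Set (Fin (n + 1))) ⊆ (D.1 : Set (Fin (n + 1)))
  rw [← edgeEnds_innerEdges (ordConnected_internal C) (nontrivial_internal C)]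
  exact (edgeEnds_mono h).trans (edgeEnds_innerEdges_subset _)

theorem exists_peak (C : CutLeaves (timeSeriesMergeTree τ)) :
    ∃ k ∈ innerEdges (C.1 : Set (Fin (n + 1))),
      ∀ l ∈ innerEdges (C.1 : Set (Fin (n + 1))), τ l ≤ τ k :=
  Set.exists_max_image _ τ (Set.toFinite _)
    (innerEdges_nonempty (ordConnected_internal C) (nontrivial_internal C))

/-- An inner edge of largest weight. -/
noncomputable def peak (C : CutLeaves (timeSeriesMergeTree τ)) : Fin n := (exists_peak C).choose

theorem peak_mem (C : CutLeaves (timeSeriesMergeTree τ)) :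
    peak C ∈ innerEdges (C.1 : Set (Fin (n + 1))) := (exists_peak C).choose_spec.1

theorem le_peak (C : CutLeaves (timeSeriesMergeTree τ)) {l : Fin n}
    (hl : l ∈ innerEdges (C.1 : Set (Fin (n + 1)))) : τ l ≤ τ (peak C) :=
  (exists_peak C).choose_spec.2 l hl

/-- The point of the merge tree of the interpolation at which the internal cluster `C` is
completed. -/
noncomputable def clusterPoint (C : CutLeaves (timeSeriesMergeTree τ)) : MergePoint (plInterpolation τ) where
  carrier := connectedComponentIn {t | plInterpolation τ t ≤ τ (peak C)} (node (peak C))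
  level := τ (peak C)
  isComponent := ⟨node (peak C), (plInterpolation_node _).le, rfl⟩

theorem node_peak_mem (C : CutLeaves (timeSeriesMergeTree τ)) :
    node (peak C) ∈ (clusterPoint C).carrier :=
  mem_connectedComponentIn (plInterpolation_node (τ := τ) (peak C)).le

theorem node_mem_clusterPoint {C : CutLeaves (timeSeriesMergeTree τ)} {k : Fin n} :
    node k ∈ (clusterPoint C).carrier ↔ k ∈ innerEdges (C.1 : Set (Fin (n + 1))) := by
  rw [MergePoint.node_mem_iff (node_peak_mem C)]
  constructor
  · intro h
    -- The level `a` defining the cluster may exceed the peak weight; only `τ (peak C) ≤ a` is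
    -- needed.
    obtain ⟨a, ha⟩ := exists_level_of_mem_timeSeriesMergeTree C.1.2
    have hC := ha _ (peak_mem C).1
    have hpeak : τ (peak C) ≤ a := by
      have h₁ := (peak_mem C).2
      rw [hC] at h₁
      exact joinedBelow_castSucc_succ.1 h₁
    exact mem_innerEdges_of_le hC fun i hi => (h i hi).trans hpeak
  · intro hk i hi
    exact le_peak C
      ((innerEdges_ordConnected (ordConnected_internal C)).uIcc_subset (peak_mem C) hk hi)

/-- The nodes in a component of a sublevel set. -/
def nodesIn (p : MergePoint (plInterpolation τ)) : Set (Fin n) := {k | node k ∈ p.carrier}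

theorem ordConnected_nodesIn (p : MergePoint (plInterpolation τ)) : (nodesIn p).OrdConnected :=
  ⟨fun _ hk _ hl _ hm =>
    p.ordConnected_carrier.out hk hl ⟨node_le_node.2 hm.1, node_le_node.2 hm.2⟩⟩

theorem edgeEnds_nodesIn_mem (p : MergePoint (plInterpolation τ)) :
    edgeEnds (nodesIn p) ∈ timeSeriesMergeTree τ := by
  obtain ⟨k, hk⟩ := p.exists_node_mem
  refine mem_timeSeriesMergeTree.2 ⟨p.level, k.castSucc, Set.ext fun i => ⟨?_, ?_⟩⟩
  · rintro ⟨l, hl, hi⟩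
    have h := (MergePoint.node_mem_iff hk).1 hl
    have h₁ := joinedBelow_castSucc_castSucc h
    rcases hi with rfl | rfl
    · exact h₁
    · exact h₁.trans (joinedBelow_castSucc_succ.2 (h l Set.right_mem_uIcc))
  · intro h
    have hi' : (i : ℕ) < n + 1 := i.2
    have hkp : τ k ≤ p.level :=
      (MergePoint.node_mem_iff hk).1 hk k Set.left_mem_uIcc
    have key : ∀ l : Fin n, (k ≤ l ∧ (l : ℕ) < i ∨ (i : ℕ) ≤ l ∧ l ≤ k) → l ∈ nodesIn p := by
      intro l hl
      refine (MergePoint.node_mem_iff hk).2 fun m hm => ?_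
      by_cases hmk : m = k
      · rwa [hmk]
      have hmk' : (m : ℕ) ≠ k := fun h => hmk (Fin.ext h)
      rw [Set.mem_uIcc] at hm
      simp only [Fin.le_def] at hm hl
      exact h m (by simp only [Fin.val_castSucc]; omega) (by simp only [Fin.val_castSucc]; omega)
    -- The last edge on the way from `k` to `i` is `i - 1` when coming from the left and `i` when
    -- coming from the right.
    rcases lt_or_ge (k : ℕ) i with hki | hki
    · refine ⟨⟨i - 1, by omega⟩, key _ (Or.inl ⟨?_, ?_⟩), Or.inr ?_⟩
      · rw [Fin.le_def]; simp only; omega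
      · simp only; omega
      · ext; simp only [Fin.val_succ]; omega
    · exact ⟨⟨i, by omega⟩, key _ (Or.inr ⟨le_rfl, hki⟩), Or.inl rfl⟩

/-- The internal cluster spanned by a component of a sublevel set of the interpolation. -/
noncomputable def pointCluster (p : MergePoint (plInterpolation τ)) : CutLeaves (timeSeriesMergeTree τ) :=
  ⟨⟨edgeEnds (nodesIn p), edgeEnds_nodesIn_mem p⟩, by
    rw [not_isMin_iff_nontrivial]
    obtain ⟨k, hk⟩ := p.exists_node_mem
    exact ⟨k.castSucc, ⟨k, hk, Or.inl rfl⟩, k.succ, ⟨k, hk, Or.inr rfl⟩,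
      Fin.castSucc_lt_succ.ne⟩⟩

theorem innerEdges_pointCluster (p : MergePoint (plInterpolation τ)) :
    innerEdges ((pointCluster p).1 : Set (Fin (n + 1))) = nodesIn p :=
  innerEdges_edgeEnds (ordConnected_nodesIn p)

theorem clusterPoint_le_iff (C : CutLeaves (timeSeriesMergeTree τ))
    (p : MergePoint (plInterpolation τ)) : clusterPoint C ≤ p ↔ C ≤ pointCluster p := by
  rw [internal_le_iff, innerEdges_pointCluster]
  constructor
  · intro h k hk
    exact h.2 (node_mem_clusterPoint.2 hk)
  · intro h
    have hpeak : node (peak C) ∈ p.carrier := h (peak_mem C)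
    -- Containing the peak node forces the level of `p` up to the peak weight, and a shared point
    -- with ordered levels suffices.
    refine MergePoint.le_of_level_le (node_peak_mem C) hpeak ?_
    have := MergePoint.apply_le_level hpeak
    rwa [plInterpolation_node] at this

/-- The internal clusters of a time series form a coreflective suborder of the merge tree of the
piecewise linear interpolation. -/
noncomputable def clusterCoinsertion (τ : Fin n → ℝ) :
    GaloisCoinsertion (clusterPoint (τ := τ)) (pointCluster (τ := τ)) :=
  GaloisConnection.toGaloisCoinsertion clusterPoint_le_iff fun C => by
    rw [internal_le_iff, innerEdges_pointCluster]
    exact fun k hk => node_mem_clusterPoint.1 hk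

end InternalClusters

/-! ### Left-to-right order -/

theorem leftOf_of_disjoint {α : Type*} [LinearOrder α] {s t : Set α} (hs : s.OrdConnected)
    (ht : t.OrdConnected) (hst : Disjoint s t) {a b : α} (ha : a ∈ s) (hb : b ∈ t) (hab : a < b) :
    LeftOf s t := by
  intro x hx y hy
  by_contra! hyx
  rcases le_total a y with h | h
  · exact Set.disjoint_left.1 hst (hs.out ha hx ⟨h, hyx⟩) hy
  · exact Set.disjoint_left.1 hst ha (ht.out hy hb ⟨h, hab.le⟩)

theorem LeftOf.disjoint {α : Type*} [Preorder α] {s t : Set α} (h : LeftOf s t) : Disjoint s t :=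
  Set.disjoint_left.2 fun a ha hb => lt_irrefl a (h a ha a hb)

/-- On both sides the sets are intervals that are nested or disjoint, and `clusterPoint` preserves
and reflects nesting; the two peaks then decide which is on the left. -/
theorem leftOf_clusterPoint_iff {n : ℕ} [NeZero n] {τ : Fin n → ℝ}
    (C D : CutLeaves (timeSeriesMergeTree τ)) :
    LeftOf (C.1 : Set (Fin (n + 1))) (D.1 : Set (Fin (n + 1))) ↔
      LeftOf (clusterPoint C).carrier (clusterPoint D).carrier := by
  have gi := clusterCoinsertion τ
  have hC := peak_mem C
  have hD := peak_mem D
  constructor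
  · intro h
    have hlt : peak C < peak D := Fin.castSucc_lt_castSucc_iff.1 (h _ hC.1 _ hD.1)
    refine leftOf_of_disjoint (clusterPoint C).ordConnected_carrier
      (clusterPoint D).ordConnected_carrier ?_ (node_peak_mem C) (node_peak_mem D)
      (node_lt_node.2 hlt)
    refine Set.disjoint_left.2 fun x hx hx' => ?_
    rcases MergePoint.le_or_le_of_mem hx hx' with hle | hle <;> rw [gi.l_le_l_iff] at hle
    · exact Set.disjoint_left.1 h.disjoint hC.1 (hle hC.1)
    · exact Set.disjoint_left.1 h.disjoint (hle hD.1) hD.1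
  · intro h
    have hlt : peak C < peak D := node_lt_node.1 (h _ (node_peak_mem C) _ (node_peak_mem D))
    refine leftOf_of_disjoint (ordConnected_internal C) (ordConnected_internal D) ?_ hC.1 hD.1
      (Fin.castSucc_lt_castSucc_iff.2 hlt)
    rcases timeSeriesMergeTree_laminar C.1.2 D.1.2 with hle | hle | hdisj
    · have hle' := gi.gc.monotone_l (show C ≤ D from hle)
      exact absurd (hle'.2 (node_peak_mem C)) (Set.disjoint_left.1 h.disjoint (node_peak_mem C))
    · have hle' := gi.gc.monotone_l (show D ≤ C from hle)
      exact absurd (node_peak_mem D) (Set.disjoint_left.1 h.disjoint (hle'.2 (node_peak_mem D)))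
    · exact hdisj

/-- The merge tree of a time series `τ` is the unique plane tree whose dual is the horizon
visibility graph of `τ`, and its first Horton pruning is isomorphic, as a plane rooted tree, to the
branch structure of the merge tree of the piecewise linear interpolation of `τ`. -/
theorem mainTheorem5 (n : ℕ) [NeZero n] (τ : Fin n → ℝ) :
    (∀ T : Set (Set (Fin (n + 1))),
      IsPlaneTree T ∧ dualGraph T = horizonVisibilityGraph τ ↔ T = timeSeriesMergeTree τ) ∧
    ∃ e : HortonPruning (timeSeriesMergeTree τ) ≃o MergeVertex (plInterpolation τ),
      ∀ u v : HortonPruning (timeSeriesMergeTree τ),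
        LeftOf (u.1.1 : Set (Fin (n + 1))) (v.1.1 : Set (Fin (n + 1))) ↔
          LeftOf (e u).1.carrier (e v).1.carrier := by
  constructor
  · intro T
    constructor
    · rintro ⟨hT, h⟩
      exact isPlaneTree_eq_of_dualGraph_eq hT (isPlaneTree_timeSeriesMergeTree τ)
        (h.trans (dualGraph_timeSeriesMergeTree τ).symm)
    · rintro rfl
      exact ⟨isPlaneTree_timeSeriesMergeTree τ, dualGraph_timeSeriesMergeTree τ⟩
  · obtain ⟨e, he⟩ := (clusterCoinsertion τ).exists_orderIso_contractChains
      MergePoint.le_or_le_of_le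
    refine ⟨e, fun u v => ?_⟩
    have hu : (e u).1 = clusterPoint u.1 := he u
    have hv : (e v).1 = clusterPoint v.1 := he v
    rw [leftOf_clusterPoint_iff, ← hu, ← hv]
    rfl
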